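/- Let $(X,\mu)$ be a $\sigma$-finite (good) measurable space, $(\mathcal E,\mathcal F)$ a Dirichlet form on $L^2(X,\mu)$ whose heat semigroup $(P_t)_{t\ge 0}$ is conservative ($P_t1=1$) and has a measurable heat kernel $p_t(x,y)$ satisfying, for some $C_h,\beta>0$, $p_t(x,y)\le C_h t^{-\beta}$ for all $t>0$ and $\mu\times\mu$-a.e. $(x,y)$. For $p\ge1$ and $\alpha\ge 0$ put $$\mathbf B^{p,\alpha}(X)=\Big\{f\in L^p(X,\mu):\ \limsup_{t\to0^+}t^{-\alpha}\Big(\int_X P_t(|f-f(y)|^p)(y)\,d\mu(y)\Big)^{1/p}<\infty\Big\},$$ $$\alpha_p=\sup\{\alpha>0:\ \mathbf B^{p,\alpha}(X)\text{ contains non a.e. constant functions}\},\qquad W^{1,p}(\mathcal E)=\mathbf B^{p,\alpha_p}(X)$$ (with $W^{1,1}(\mathcal E):=BV(\mathcal E)$), and for $f\in W^{1,p}(\mathcal E)$ $$\mathbf{Var}_{p,\mathcal E}(f)=\liminf_{t\to0^+}t^{-\alpha_p}\Big(\int_X P_t(|f-f(y)|^p)(y)\,d\mu(y)\Big)^{1/p}.$$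 Suppose that for some $p\ge 1$ with $p\,\alpha_p<\beta$ the $L^p$ pseudo-Poincaré inequality $(\mathrm{PPI}_p)$ holds: there is $C_p>0$ such that $\|P_tf-f\|_{L^p(X,\mu)}\le C_p\,t^{\alpha_p}\,\mathbf{Var}_{p,\mathcal E}(f)$ for all $t\ge0$ and $f\in W^{1,p}(\mathcal E)$. Then for all $r,s\in[1,+\infty]$ there is a constant $C_{p,r,s}>0$ such that, for every $\theta\in(0,1]$ with $$\frac1r=\theta\Big(\frac1p-\frac{\alpha_p}{\beta}\Big)+\frac{1-\theta}{s}$$ (where $1/\infty=0$) and every $f\in W^{1,p}(\mathcal E)$, $$\|f\|_{L^r(X,\mu)}\le C_{p,r,s}\,\mathbf{Var}_{p,\mathcal E}(f)^{\theta}\,\|f\|_{L^s(X,\mu)}^{1-\theta}.$$ The inequality is understood in $[0,\infty]$, with $0\cdot\infty=0$ and $a^0=1$ for every $a\in[0,\infty]$. -/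

import Mathlib

open MeasureTheory Filter Topology
open scoped ENNReal NNReal

/-- A (symmetric) Dirichlet form `(𝓔, 𝓕)` on the real Hilbert space `L²(X, μ)`: a densely defined,
nonnegative, symmetric bilinear form which is closed (its domain is complete for the norm
`(𝓔(u,u) + ‖u‖²)^{1/2}`) and Markovian (the unit contraction operates on it). -/
structure DirichletForm {X : Type*} [MeasurableSpace X] (μ : Measure X) where
  /-- the domain `𝓕` -/
  domain : Submodule ℝ (Lp ℝ 2 μ)
  /-- the bilinear form `𝓔` -/
  form : domain →ₗ[ℝ] domain →ₗ[ℝ] ℝ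
  dense : Dense (domain : Set (Lp ℝ 2 μ))
  symm : ∀ u v : domain, form u v = form v u
  nonneg : ∀ u : domain, 0 ≤ form u u
  closed : ∀ u : ℕ → domain,
    (∀ ε : ℝ, 0 < ε → ∃ N : ℕ, ∀ m ≥ N, ∀ n ≥ N,
      form (u m - u n) (u m - u n) + ‖u m - u n‖ ^ 2 < ε) →
    ∃ v : domain,
      Tendsto (fun n => form (u n - v) (u n - v) + ‖u n - v‖ ^ 2) atTop (𝓝 0)
  markov : ∀ (u : domain) (v : Lp ℝ 2 μ),
    (∀ᵐ x ∂μ, v x = min (max ((u : Lp ℝ 2 μ) x) 0) 1) →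
    ∃ hv : v ∈ domain, form ⟨v, hv⟩ ⟨v, hv⟩ ≤ form u u

/-- `P` is the heat semigroup of the Dirichlet form `𝓔`: the (unique) strongly continuous semigroup
`(P_t)_{t ≥ 0}` of symmetric contractions of `L²(X, μ)` such that `𝓕` consists of those `u` for
which `t⁻¹ ⟨u - P_t u, u⟩` converges as `t → 0⁺`, and `𝓔(u, v) = lim t⁻¹ ⟨u - P_t u, v⟩` on `𝓕`.
Only the values `P t` with `0 ≤ t` matter. -/
structure DirichletForm.IsHeatSemigroup {X : Type*} [MeasurableSpace X] {μ : Measure X}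
    (𝓔 : DirichletForm μ) (P : ℝ → (Lp ℝ 2 μ →L[ℝ] Lp ℝ 2 μ)) : Prop where
  zero : P 0 = ContinuousLinearMap.id ℝ (Lp ℝ 2 μ)
  add : ∀ s t : ℝ, 0 ≤ s → 0 ≤ t → P (s + t) = (P s).comp (P t)
  contraction : ∀ (t : ℝ), 0 ≤ t → ∀ f : Lp ℝ 2 μ, ‖P t f‖ ≤ ‖f‖
  symm : ∀ (t : ℝ), 0 ≤ t → ∀ f g : Lp ℝ 2 μ, inner ℝ (P t f) g = inner ℝ f (P t g)
  continuous : ∀ f : Lp ℝ 2 μ, Tendsto (fun t : ℝ => P t f) (𝓝[>] 0) (𝓝 f)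
  mem_domain_iff : ∀ u : Lp ℝ 2 μ, u ∈ 𝓔.domain ↔
    ∃ l : ℝ, Tendsto (fun t : ℝ => t⁻¹ * inner ℝ (u - P t u) u) (𝓝[>] 0) (𝓝 l)
  tendsto_form : ∀ u v : 𝓔.domain,
    Tendsto (fun t : ℝ => t⁻¹ * inner ℝ ((u : Lp ℝ 2 μ) - P t u) (v : Lp ℝ 2 μ))
      (𝓝[>] 0) (𝓝 (𝓔.form u v))

/-- `k` is a heat kernel of the semigroup `P`: for each `t > 0`, the function `k t` is nonnegative
and jointly measurable, and it is the integral kernel of `P t` with respect to `μ`. -/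
structure IsHeatKernel {X : Type*} [MeasurableSpace X] (μ : Measure X)
    (P : ℝ → (Lp ℝ 2 μ →L[ℝ] Lp ℝ 2 μ)) (k : ℝ → X → X → ℝ≥0) : Prop where
  measurable : ∀ t : ℝ, 0 < t → Measurable (fun z : X × X => k t z.1 z.2)
  represents : ∀ t : ℝ, 0 < t → ∀ f : Lp ℝ 2 μ, ∀ᵐ x ∂μ,
    Integrable (fun y => (k t x y : ℝ) * f y) μ ∧ P t f x = ∫ y, (k t x y : ℝ) * f y ∂μ

/-- Conservativeness `P_t 1 = 1` for all `t > 0`. -/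
def IsConservative {X : Type*} [MeasurableSpace X] (μ : Measure X)
    (k : ℝ → X → X → ℝ≥0) : Prop :=
  ∀ t : ℝ, 0 < t → ∀ᵐ x ∂μ, ∫⁻ y, (k t x y : ℝ≥0∞) ∂μ = 1

/-- The action of the heat semigroup at time `t > 0` on a function in any `Lᵖ(X, μ)`:
`P_t f (x) = ∫ p_t(x, y) f(y) dμ(y)`. -/
noncomputable def heatOp {X : Type*} [MeasurableSpace X] (μ : Measure X)
    (k : ℝ → X → X → ℝ≥0) (t : ℝ) (f : X → ℝ) (x : X) : ℝ :=
  ∫ y, (k t x y : ℝ) * f y ∂μ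

/-- `(∫ P_t(|f - f(y)|ᵖ)(y) dμ(y))^{1/p}`, as an extended nonnegative number. -/
noncomputable def heatVariation {X : Type*} [MeasurableSpace X] (μ : Measure X)
    (k : ℝ → X → X → ℝ≥0) (p t : ℝ) (f : X → ℝ) : ℝ≥0∞ :=
  (∫⁻ y, ∫⁻ x, (k t y x : ℝ≥0∞) * ‖f x - f y‖ₑ ^ p ∂μ ∂μ) ^ (1 / p)

/-- The heat semigroup based Besov class `𝐁^{p,α}(X)`. -/
def besovClass {X : Type*} [MeasurableSpace X] (μ : Measure X)
    (k : ℝ → X → X → ℝ≥0) (p α : ℝ) : Set (X → ℝ) :=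
  {f | MemLp f (ENNReal.ofReal p) μ ∧
    limsup (fun t : ℝ => ENNReal.ofReal (t ^ (-α)) * heatVariation μ k p t f) (𝓝[>] 0) < ∞}

/-- The critical exponent `α_p`: the supremum of the `α > 0` for which `𝐁^{p,α}(X)` contains a
function that is not a.e. constant. (When the heat kernel satisfies `p_t ≤ C t^{-β}` for all `t > 0`
this set is bounded above.) -/
noncomputable def critExponent {X : Type*} [MeasurableSpace X] (μ : Measure X)
    (k : ℝ → X → X → ℝ≥0) (p : ℝ) : ℝ :=
  sSup {α : ℝ | 0 < α ∧ ∃ f ∈ besovClass μ k p α, ¬ ∃ c : ℝ, ∀ᵐ x ∂μ, f x = c}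

/-- The heat semigroup based Sobolev class `W^{1,p}(𝓔) = 𝐁^{p,α_p}(X)`; for `p = 1` this is the
class `BV(𝓔)`. -/
noncomputable def sobolevClass {X : Type*} [MeasurableSpace X] (μ : Measure X)
    (k : ℝ → X → X → ℝ≥0) (p : ℝ) : Set (X → ℝ) :=
  besovClass μ k p (critExponent μ k p)

/-- The total `p`-variation
`Var_{p,𝓔}(f) = liminf_{t → 0⁺} t^{-α_p} (∫ P_t(|f - f(y)|ᵖ)(y) dμ(y))^{1/p}`. -/
noncomputable def totalVar {X : Type*} [MeasurableSpace X] (μ : Measure X)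
    (k : ℝ → X → X → ℝ≥0) (p : ℝ) (f : X → ℝ) : ℝ≥0∞ :=
  liminf (fun t : ℝ => ENNReal.ofReal (t ^ (-critExponent μ k p)) * heatVariation μ k p t f)
    (𝓝[>] 0)

/-- The `Lᵖ` pseudo-Poincaré inequality `(PPI_p)`: there is `C > 0` with
`‖P_t f - f‖_{Lᵖ} ≤ C t^{α_p} Var_{p,𝓔}(f)` for all `t` and all `f ∈ W^{1,p}(𝓔)`.
(At `t = 0` it is void, since `P_0 f = f`.) -/
def PseudoPoincare {X : Type*} [MeasurableSpace X] (μ : Measure X)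
    (k : ℝ → X → X → ℝ≥0) (p : ℝ) : Prop :=
  ∃ C : ℝ, 0 < C ∧ ∀ t : ℝ, 0 < t → ∀ f ∈ sobolevClass μ k p,
    eLpNorm (fun x => heatOp μ k t f x - f x) (ENNReal.ofReal p) μ
      ≤ ENNReal.ofReal (C * t ^ critExponent μ k p) * totalVar μ k p f

/-- The heat kernel upper bound `p_t(x, y) ≤ C t^{-β}` for all `t > 0` and
`μ × μ`-a.e. `(x, y)`. -/
def HeatKernelUpperBound {X : Type*} [MeasurableSpace X] (μ : Measure X)
    (k : ℝ → X → X → ℝ≥0) (β : ℝ) : Prop :=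
  ∃ C : ℝ, 0 < C ∧ ∀ t : ℝ, 0 < t → ∀ᵐ z ∂(μ.prod μ), (k t z.1 z.2 : ℝ) ≤ C * t ^ (-β)

/-! Maz'ya truncation. Cut `|f|` into dyadic slices `f_j`. The increments of the slices add up to at
most the increment of `f`, so for `p ≥ 1` the numbers `Var(f_j) ^ p` sum to at most `Var(f) ^ p`.
Where `|f| ≥ 2^(j+1)`, `f_j` equals `2^j`. The kernel bound makes `|P_t f_j| ≤ 2^j / 2` for a
suitable `t`, and (PPI_p) with Chebyshev then bounds `μ(|f| ≥ 2^(j+1))` by `2^(-jp) μ(|f| ≥ 2^j)^δ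
Var(f_j)^p`, up to a constant, with `δ = p α_p / β < 1` (`measure_level_succ_le`). For `q = p / (1 -
δ)` and `a_j = 2^(jq) μ(|f| ≥ 2^j)` this is a sublinear recursion, which sums to the Sobolev bound
`‖f‖_q ≤ C Var(f)` (`eLpNorm_le_mul_totalVar`). Hölder interpolation between `L^q` and `L^s` gives
the rest. -/

/-! ### Dyadic truncation -/

/-- The dyadic slice of `|a|` between the levels `2 ^ k` and `2 ^ (k + 1)`, shifted to start
at `0`. -/
noncomputable def dyadicSlice (k : ℤ) (a : ℝ) : ℝ :=
  min (max (|a| - 2 ^ k) 0) (2 ^ k)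

lemma dyadicSlice_eq_sub (k : ℤ) (a : ℝ) :
    dyadicSlice k a = max (|a| - 2 ^ k) 0 - max (|a| - 2 ^ (k + 1)) 0 := by
  have h2 : (0 : ℝ) < 2 ^ k := by positivity
  have h : (2 : ℝ) ^ (k + 1) = 2 * 2 ^ k := by rw [zpow_add_one₀ two_ne_zero]; ring
  rw [dyadicSlice, h]
  rcases le_total (|a| - 2 ^ k) 0 with h1 | h1 <;>
    rcases le_total (|a| - 2 * 2 ^ k) 0 with h3 | h3 <;>
    simp only [max_eq_left, max_eq_right, h1, h3] <;>
    rcases le_total (|a| - 2 ^ k) (2 ^ k) with h4 | h4 <;>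
    simp [h2.le, h4] <;> linarith

lemma continuous_dyadicSlice (k : ℤ) : Continuous (dyadicSlice k) := by
  unfold dyadicSlice; fun_prop

lemma dyadicSlice_nonneg (k : ℤ) (a : ℝ) : 0 ≤ dyadicSlice k a :=
  le_min (le_max_right _ _) (by positivity)

lemma dyadicSlice_le (k : ℤ) (a : ℝ) : dyadicSlice k a ≤ 2 ^ k := min_le_right _ _

lemma dyadicSlice_le_abs (k : ℤ) (a : ℝ) : dyadicSlice k a ≤ |a| :=
  (min_le_left _ _).trans (max_le (by linarith [zpow_pos (two_pos (α := ℝ)) k]) (abs_nonneg a))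

lemma dyadicSlice_eq_zero {k : ℤ} {a : ℝ} (h : |a| < 2 ^ k) : dyadicSlice k a = 0 := by
  have h2 : (0 : ℝ) < 2 ^ k := by positivity
  rw [dyadicSlice, max_eq_right (by linarith), min_eq_left h2.le]

lemma dyadicSlice_eq_top {k : ℤ} {a : ℝ} (h : 2 ^ (k + 1) ≤ |a|) : dyadicSlice k a = 2 ^ k := by
  rw [zpow_add_one₀ two_ne_zero] at h
  rw [dyadicSlice, min_eq_right (le_max_of_le_left (by linarith))]

lemma sum_Ico_dyadicSlice {m n : ℤ} (hmn : m ≤ n) (a : ℝ) :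
    ∑ k ∈ Finset.Ico m n, dyadicSlice k a = max (|a| - 2 ^ m) 0 - max (|a| - 2 ^ n) 0 := by
  induction n, hmn using Int.leInduction with
  | base => simp
  | succ n hn ih =>
    rw [← Finset.insert_Ico_right_eq_Ico_add_one hn, Finset.sum_insert (by simp), ih,
      dyadicSlice_eq_sub]
    ring

lemma dyadicSlice_mono {k : ℤ} {a b : ℝ} (h : |a| ≤ |b|) : dyadicSlice k a ≤ dyadicSlice k b := by
  unfold dyadicSlice; gcongr

/-- Slices are monotone in `|a|`, so once `|b| ≤ |a|` the absolute values drop and the sum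
telescopes. -/
lemma sum_abs_dyadicSlice_sub_le (s : Finset ℤ) (a b : ℝ) :
    ∑ k ∈ s, |dyadicSlice k a - dyadicSlice k b| ≤ |a - b| := by
  wlog hab : |b| ≤ |a| generalizing a b
  · simpa only [abs_sub_comm] using this b a (le_of_not_ge hab)
  have hs : ∃ m n : ℤ, m ≤ n ∧ s ⊆ Finset.Ico m n := by
    obtain ⟨m, hm⟩ := s.bddBelow
    obtain ⟨n, hn⟩ := s.bddAbove
    refine ⟨m, max m (n + 1), le_max_left _ _, fun k hk => Finset.mem_Ico.2 ⟨hm hk, ?_⟩⟩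
    exact lt_max_of_lt_right (Int.lt_add_one_of_le (hn hk))
  obtain ⟨m, n, hmn, hs⟩ := hs
  calc ∑ k ∈ s, |dyadicSlice k a - dyadicSlice k b|
      ≤ ∑ k ∈ Finset.Ico m n, |dyadicSlice k a - dyadicSlice k b| :=
        Finset.sum_le_sum_of_subset_of_nonneg hs fun _ _ _ => abs_nonneg _
    _ = ∑ k ∈ Finset.Ico m n, (dyadicSlice k a - dyadicSlice k b) :=
        Finset.sum_congr rfl fun k _ => abs_of_nonneg (sub_nonneg.2 (dyadicSlice_mono hab))
    _ ≤ |a| - |b| := by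
        rw [Finset.sum_sub_distrib, sum_Ico_dyadicSlice hmn, sum_Ico_dyadicSlice hmn]
        have h1 : max (|b| - 2 ^ n) 0 ≤ max (|a| - (2 : ℝ) ^ n) 0 := by gcongr
        have h2 : max (|a| - (2 : ℝ) ^ m) 0 ≤ max (|b| - 2 ^ m) 0 + (|a| - |b|) :=
          max_le (by linarith [le_max_left (|b| - (2 : ℝ) ^ m) 0])
            (by linarith [le_max_right (|b| - (2 : ℝ) ^ m) 0])
        linarith
    _ ≤ |a - b| := abs_sub_abs_le_abs_sub a b

lemma ENNReal.sum_rpow_le_rpow_sum {ι : Type*} (s : Finset ι) (f : ι → ℝ≥0∞) {p : ℝ}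
    (hp : 1 ≤ p) : ∑ i ∈ s, f i ^ p ≤ (∑ i ∈ s, f i) ^ p := by
  classical
  induction s using Finset.induction_on with
  | empty => simp
  | insert a s ha ih =>
    rw [Finset.sum_insert ha, Finset.sum_insert ha]
    exact (add_le_add_right ih _).trans (ENNReal.add_rpow_le_rpow_add _ _ hp)

lemma tsum_enorm_dyadicSlice_sub_rpow_le {p : ℝ} (hp : 1 ≤ p) (a b : ℝ) :
    ∑' k, ‖dyadicSlice k a - dyadicSlice k b‖ₑ ^ p ≤ ‖a - b‖ₑ ^ p := by
  rw [ENNReal.tsum_eq_iSup_sum]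
  refine iSup_le fun s => (ENNReal.sum_rpow_le_rpow_sum s _ hp).trans ?_
  refine ENNReal.rpow_le_rpow ?_ (by linarith)
  simp only [Real.enorm_eq_ofReal_abs]
  rw [← ENNReal.ofReal_sum_of_nonneg fun _ _ => abs_nonneg _]
  exact ENNReal.ofReal_le_ofReal (sum_abs_dyadicSlice_sub_le s a b)

/-- The lower integral is superadditive, so this direction needs no measurability. -/
lemma tsum_lintegral_le_lintegral_tsum {X ι : Type*} [MeasurableSpace X] (μ : Measure X)
    (f : ι → X → ℝ≥0∞) : ∑' i, ∫⁻ x, f i x ∂μ ≤ ∫⁻ x, ∑' i, f i x ∂μ := by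
  classical
  rw [ENNReal.tsum_eq_iSup_sum]
  refine iSup_le fun s => le_trans ?_
    (lintegral_mono fun x => ENNReal.sum_le_tsum s)
  induction s using Finset.induction_on with
  | empty => simp
  | insert a s ha ih =>
    simp only [Finset.sum_insert ha]
    exact (add_le_add_right ih _).trans (le_lintegral_add _ _)

/-! ### Variation of the slices -/

section

variable {X : Type*} [MeasurableSpace X] {μ : Measure X} {k : ℝ → X → X → ℝ≥0}

lemma heatVariation_rpow {p : ℝ} (hp : 1 ≤ p) (t : ℝ) (f : X → ℝ) :
    heatVariation μ k p t f ^ p =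
      ∫⁻ y, ∫⁻ x, (k t y x : ℝ≥0∞) * ‖f x - f y‖ₑ ^ p ∂μ ∂μ := by
  rw [heatVariation, ← ENNReal.rpow_mul, one_div_mul_cancel (by linarith), ENNReal.rpow_one]

lemma tsum_heatVariation_dyadicSlice_rpow_le {p : ℝ} (hp : 1 ≤ p) (t : ℝ) (f : X → ℝ) :
    ∑' j, heatVariation μ k p t (fun x => dyadicSlice j (f x)) ^ p ≤
      heatVariation μ k p t f ^ p := by
  simp only [heatVariation_rpow hp]
  refine (tsum_lintegral_le_lintegral_tsum _ _).trans (lintegral_mono fun y => ?_)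
  refine (tsum_lintegral_le_lintegral_tsum _ _).trans (lintegral_mono fun x => ?_)
  rw [ENNReal.tsum_mul_left]
  gcongr
  exact tsum_enorm_dyadicSlice_sub_rpow_le hp _ _

lemma heatVariation_dyadicSlice_le {p : ℝ} (hp : 1 ≤ p) (t : ℝ) (f : X → ℝ) (j : ℤ) :
    heatVariation μ k p t (fun x => dyadicSlice j (f x)) ≤ heatVariation μ k p t f :=
  (ENNReal.rpow_le_rpow_iff (by linarith : 0 < p)).1 <|
    (ENNReal.le_tsum j).trans (tsum_heatVariation_dyadicSlice_rpow_le hp t f)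

lemma dyadicSlice_mem_besovClass {p α : ℝ} (hp : 1 ≤ p) {f : X → ℝ}
    (hf : f ∈ besovClass μ k p α) (j : ℤ) :
    (fun x => dyadicSlice j (f x)) ∈ besovClass μ k p α := by
  refine ⟨hf.1.mono ((continuous_dyadicSlice j).comp_aestronglyMeasurable hf.1.1)
    (Eventually.of_forall fun x => ?_), lt_of_le_of_lt (limsup_le_limsup ?_) hf.2⟩
  · rw [Real.norm_of_nonneg (dyadicSlice_nonneg _ _)]
    exact dyadicSlice_le_abs _ _
  · exact Eventually.of_forall fun t => mul_le_mul_right (heatVariation_dyadicSlice_le hp t f j) _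

lemma totalVar_rpow {p : ℝ} (hp : 1 ≤ p) (f : X → ℝ) :
    totalVar μ k p f ^ p =
      liminf (fun t : ℝ => (ENNReal.ofReal (t ^ (-critExponent μ k p)) *
        heatVariation μ k p t f) ^ p) (𝓝[>] 0) :=
  (ENNReal.orderIsoRpow p (by linarith)).liminf_apply

/-- Fatou for the counting measure on `ℤ` moves the sum inside the liminf; at fixed `t` the bound is
pointwise. -/
lemma tsum_totalVar_dyadicSlice_rpow_le {p : ℝ} (hp : 1 ≤ p) (f : X → ℝ) :
    ∑' j, totalVar μ k p (fun x => dyadicSlice j (f x)) ^ p ≤ totalVar μ k p f ^ p := by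
  simp only [totalVar_rpow hp]
  rw [← lintegral_count]
  refine (lintegral_liminf_le' fun t => (measurable_of_countable _).aemeasurable).trans ?_
  refine liminf_le_liminf (Eventually.of_forall fun t => ?_)
  simp only [lintegral_count]
  simp only [ENNReal.mul_rpow_of_nonneg _ _ (by linarith : 0 ≤ p), ENNReal.tsum_mul_left]
  gcongr
  exact tsum_heatVariation_dyadicSlice_rpow_le hp t f

lemma critExponent_nonneg (p : ℝ) : 0 ≤ critExponent μ k p :=
  Real.sSup_nonneg fun _ h => h.1.le

end

/-! ### From pseudo-Poincaré to level sets -/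

section

variable {X : Type*} [MeasurableSpace X] {μ : Measure X} {k : ℝ → X → X → ℝ≥0}

lemma aestronglyMeasurable_heatOp [SigmaFinite μ] {t : ℝ}
    (hk : Measurable fun z : X × X => k t z.1 z.2) {f : X → ℝ} (hf : AEStronglyMeasurable f μ) :
    AEStronglyMeasurable (heatOp μ k t f) μ := by
  have h : AEStronglyMeasurable (fun z : X × X => (k t z.1 z.2 : ℝ) * f z.2) (μ.prod μ) :=
    (hk.coe_nnreal_real.aestronglyMeasurable).mul hf.comp_snd
  exact h.integral_prod_right'

/-- `w dμ` is a probability measure, so its `L¹` norm is at most its `Lᵖ` norm; only then is `w`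
replaced by `M`. -/
lemma enorm_integral_mul_le_of_lintegral_eq_one {w : X → ℝ≥0} (hw : Measurable w)
    (hw1 : ∫⁻ y, (w y : ℝ≥0∞) ∂μ = 1) {M : ℝ≥0∞} (hM : ∀ᵐ y ∂μ, (w y : ℝ≥0∞) ≤ M)
    {p : ℝ} (hp : 1 ≤ p) {f : X → ℝ} (hf : AEStronglyMeasurable f μ) :
    ‖∫ y, (w y : ℝ) * f y ∂μ‖ₑ ≤ M ^ (1 / p) * eLpNorm f (ENNReal.ofReal p) μ := by
  have hp0 : 0 < p := by linarith
  set ν : Measure X := μ.withDensity fun y => (w y : ℝ≥0∞) with hν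
  have hac : ν ≪ μ := withDensity_absolutelyContinuous _ _
  have : IsProbabilityMeasure ν := ⟨by rw [hν, withDensity_apply _ .univ]; simpa using hw1⟩
  have hlint : ∀ g : X → ℝ≥0∞, AEMeasurable g μ →
      ∫⁻ y, g y ∂ν = ∫⁻ y, (w y : ℝ≥0∞) * g y ∂μ := fun g hg => by
    rw [hν, lintegral_withDensity_eq_lintegral_mul₀ hw.coe_nnreal_ennreal.aemeasurable hg]
    rfl
  calc ‖∫ y, (w y : ℝ) * f y ∂μ‖ₑ ≤ ∫⁻ y, ‖(w y : ℝ) * f y‖ₑ ∂μ :=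
        enorm_integral_le_lintegral_enorm _
    _ = ∫⁻ y, ‖f y‖ₑ ∂ν := by
        rw [hlint _ hf.enorm]
        refine lintegral_congr fun y => ?_
        rw [enorm_mul, enorm_eq_nnnorm (w y : ℝ), NNReal.nnnorm_eq]
    _ = eLpNorm f 1 ν := eLpNorm_one_eq_lintegral_enorm.symm
    _ ≤ eLpNorm f (ENNReal.ofReal p) ν :=
        eLpNorm_le_eLpNorm_of_exponent_le (by simpa using hp) (hf.mono_ac hac)
    _ = (∫⁻ y, (w y : ℝ≥0∞) * ‖f y‖ₑ ^ p ∂μ) ^ (1 / p) := by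
        rw [eLpNorm_eq_lintegral_rpow_enorm_toReal (by simpa using hp0) (by simp),
          ENNReal.toReal_ofReal hp0.le, hlint _ (hf.enorm.pow_const p)]
    _ ≤ (∫⁻ y, M * ‖f y‖ₑ ^ p ∂μ) ^ (1 / p) := by
        refine ENNReal.rpow_le_rpow (lintegral_mono_ae ?_) (by positivity)
        filter_upwards [hM] with y hy
        gcongr
    _ = M ^ (1 / p) * eLpNorm f (ENNReal.ofReal p) μ := by
        rw [lintegral_const_mul'' _ (hf.enorm.pow_const p),
          ENNReal.mul_rpow_of_nonneg _ _ (by positivity),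
          eLpNorm_eq_lintegral_rpow_enorm_toReal (by simpa using hp0) (by simp),
          ENNReal.toReal_ofReal hp0.le]

lemma ae_enorm_heatOp_le [SigmaFinite μ] {t : ℝ} (hk : Measurable fun z : X × X => k t z.1 z.2)
    (hcons : ∀ᵐ x ∂μ, ∫⁻ y, (k t x y : ℝ≥0∞) ∂μ = 1) {M : ℝ}
    (hM : ∀ᵐ z ∂(μ.prod μ), (k t z.1 z.2 : ℝ) ≤ M) {p : ℝ} (hp : 1 ≤ p) {f : X → ℝ}
    (hf : AEStronglyMeasurable f μ) :
    ∀ᵐ x ∂μ, ‖heatOp μ k t f x‖ₑ ≤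
      ENNReal.ofReal M ^ (1 / p) * eLpNorm f (ENNReal.ofReal p) μ := by
  filter_upwards [hcons, Measure.ae_ae_of_ae_prod hM] with x hx hMx
  refine enorm_integral_mul_le_of_lintegral_eq_one (hk.comp measurable_prodMk_left) hx ?_ hp hf
  filter_upwards [hMx] with y hy
  rw [← ENNReal.ofReal_coe_nnreal]
  exact ENNReal.ofReal_le_ofReal hy

lemma eLpNorm_dyadicSlice_le {p : ℝ} (hp : 0 < p) {f : X → ℝ} (hf : AEStronglyMeasurable f μ)
    (j : ℤ) :
    eLpNorm (fun x => dyadicSlice j (f x)) (ENNReal.ofReal p) μ ≤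
      ENNReal.ofReal (2 ^ j) * μ {x | 2 ^ j ≤ |f x|} ^ (1 / p) := by
  have hS : NullMeasurableSet {x | 2 ^ j ≤ |f x|} μ :=
    nullMeasurableSet_le aemeasurable_const hf.aemeasurable.abs
  calc eLpNorm (fun x => dyadicSlice j (f x)) (ENNReal.ofReal p) μ
      ≤ eLpNorm ({x | 2 ^ j ≤ |f x|}.indicator fun _ => (2 : ℝ) ^ j) (ENNReal.ofReal p) μ := by
        refine eLpNorm_mono_real fun x => ?_
        rw [Real.norm_of_nonneg (dyadicSlice_nonneg _ _)]
        by_cases hx : 2 ^ j ≤ |f x|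
        · rw [Set.indicator_of_mem (show x ∈ {x | 2 ^ j ≤ |f x|} from hx)]
          exact dyadicSlice_le _ _
        · rw [Set.indicator_of_notMem (show x ∉ {x | 2 ^ j ≤ |f x|} from hx),
            dyadicSlice_eq_zero (not_le.1 hx)]
    _ = _ := by
        rw [eLpNorm_indicator_const₀ hS (by simpa using hp) (by simp),
          ENNReal.toReal_ofReal hp.le, Real.enorm_of_nonneg (by positivity)]

lemma measure_le_abs_le {p : ℝ} (hp : 0 < p) {f : X → ℝ} (hf : AEStronglyMeasurable f μ)
    {a : ℝ} (ha : 0 < a) :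
    μ {x | a ≤ |f x|} ≤ ENNReal.ofReal (a ^ (-p)) * eLpNorm f (ENNReal.ofReal p) μ ^ p := by
  have h := meas_ge_le_mul_pow_eLpNorm_enorm μ (p := ENNReal.ofReal p) (by simpa using hp)
    (by simp) hf (ε := ENNReal.ofReal a) (by simpa using ha) (by simp)
  rw [ENNReal.toReal_ofReal hp.le, ENNReal.inv_rpow, ENNReal.ofReal_rpow_of_pos ha,
    ← ENNReal.ofReal_inv_of_pos (by positivity), ← Real.rpow_neg ha.le] at h
  refine le_trans (measure_mono fun x hx => ?_) h
  simpa [Real.enorm_eq_ofReal_abs] using ENNReal.ofReal_le_ofReal hx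

/-- Where `|f| ≥ a` and `|g| ≤ a / 2`, the difference is at least `a / 2`, and Chebyshev applies. -/
lemma measure_le_abs_le_of_enorm_le {p : ℝ} (hp : 0 < p) {f g : X → ℝ}
    (hf : AEStronglyMeasurable f μ) (hg : AEStronglyMeasurable g μ) {a : ℝ} (ha : 0 < a)
    (hga : ∀ᵐ x ∂μ, ‖g x‖ₑ ≤ ENNReal.ofReal (a / 2)) :
    μ {x | a ≤ |f x|} ≤
      ENNReal.ofReal ((a / 2) ^ (-p)) *
        eLpNorm (fun x => g x - f x) (ENNReal.ofReal p) μ ^ p := by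
  refine le_trans (measure_mono_ae ?_) (measure_le_abs_le hp (hg.sub hf) (half_pos ha))
  filter_upwards [hga] with x hx hax
  rw [Real.enorm_eq_ofReal_abs, ENNReal.ofReal_le_ofReal_iff (by positivity)] at hx
  have h1 : a ≤ |f x| := hax
  have h2 := abs_sub_abs_le_abs_sub (f x) (g x)
  change a / 2 ≤ |g x - f x|
  rw [abs_sub_comm]
  linarith

lemma measure_level_succ_le [SigmaFinite μ] {β : ℝ} (hβ : 0 < β)
    (hk : ∀ t : ℝ, 0 < t → Measurable fun z : X × X => k t z.1 z.2)
    (hcons : IsConservative μ k) (hbound : HeatKernelUpperBound μ k β)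
    {p : ℝ} (hp : 1 ≤ p) (hPPI : PseudoPoincare μ k p) :
    ∃ K : ℝ, 0 < K ∧ ∀ f ∈ sobolevClass μ k p, ∀ j : ℤ,
      μ {x | 2 ^ (j + 1) ≤ |f x|} ≤
        ENNReal.ofReal (K * ((2 : ℝ) ^ j) ^ (-p)) *
          μ {x | 2 ^ j ≤ |f x|} ^ (p * critExponent μ k p / β) *
          totalVar μ k p (fun x => dyadicSlice j (f x)) ^ p := by
  obtain ⟨A, hA, hbound⟩ := hbound
  obtain ⟨C, hC, hPPI⟩ := hPPI
  have hp0 : 0 < p := by linarith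
  set α := critExponent μ k p with hα
  refine ⟨2 ^ p * C ^ p * (2 ^ p * A) ^ (p * α / β), by positivity, fun f hf j => ?_⟩
  have hfm : AEStronglyMeasurable f μ := hf.1.1
  set g : X → ℝ := fun x => dyadicSlice j (f x) with hg
  have hgW : g ∈ sobolevClass μ k p := dyadicSlice_mem_besovClass hp hf j
  have hgm : AEStronglyMeasurable g μ := hgW.1.1
  have hj : (0 : ℝ) < 2 ^ j := by positivity
  have hsub : {x | (2 : ℝ) ^ (j + 1) ≤ |f x|} ⊆ {x | 2 ^ j ≤ |g x|} := fun x hx => by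
    change 2 ^ j ≤ |dyadicSlice j (f x)|
    rw [dyadicSlice_eq_top hx]
    exact le_abs_self _
  have hmfin : μ {x | 2 ^ j ≤ |f x|} ≠ ∞ := by
    refine ne_top_of_le_ne_top ?_ (measure_le_abs_le hp0 hfm hj)
    exact ENNReal.mul_ne_top ENNReal.ofReal_ne_top
      (ENNReal.rpow_ne_top_of_nonneg hp0.le hf.1.2.ne)
  -- A null level set would give the time `t = 0` below.
  rcases eq_or_ne (μ {x | 2 ^ j ≤ |f x|}) 0 with hm0 | hm0
  · refine le_of_eq_of_le (measure_mono_null (fun x hx => ?_) hm0) zero_le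
    have hx1 : (2 : ℝ) ^ (j + 1) ≤ |f x| := hx
    exact (zpow_le_zpow_right₀ one_le_two (lt_add_one j).le).trans hx1
  set m : ℝ := (μ {x | 2 ^ j ≤ |f x|}).toReal with hm
  have hmpos : 0 < m := ENNReal.toReal_pos hm0 hmfin
  have hmeq : μ {x | 2 ^ j ≤ |f x|} = ENNReal.ofReal m := (ENNReal.ofReal_toReal hmfin).symm
  -- Solves `(A t^(-β))^(1/p) * 2^j * m^(1/p) = 2^j / 2`, whose left side bounds `|P_t g|`.
  set t : ℝ := (2 ^ p * A * m) ^ (1 / β) with ht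
  have htpos : 0 < t := by positivity
  have hsmall : ∀ᵐ x ∂μ, ‖heatOp μ k t g x‖ₑ ≤ ENNReal.ofReal (2 ^ j / 2) := by
    filter_upwards [ae_enorm_heatOp_le (hk t htpos) (hcons t htpos) (hbound t htpos) hp hgm]
      with x hx
    refine hx.trans ((mul_le_mul_right (eLpNorm_dyadicSlice_le hp0 hfm j) _).trans_eq ?_)
    rw [hmeq, ENNReal.ofReal_rpow_of_pos (by positivity), ENNReal.ofReal_rpow_of_pos hmpos,
      ← ENNReal.ofReal_mul (by positivity), ← ENNReal.ofReal_mul (by positivity)]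
    congr 1
    have h1 : A * t ^ (-β) = (2 ^ p)⁻¹ * m⁻¹ := by
      rw [ht, ← Real.rpow_mul (by positivity), mul_neg, one_div_mul_cancel hβ.ne',
        Real.rpow_neg_one]
      field_simp
    rw [h1, Real.mul_rpow (by positivity) (by positivity), Real.inv_rpow (by positivity),
      Real.inv_rpow (by positivity), ← Real.rpow_mul (by positivity),
      mul_one_div_cancel hp0.ne', Real.rpow_one]
    field_simp
  calc μ {x | 2 ^ (j + 1) ≤ |f x|} ≤ μ {x | 2 ^ j ≤ |g x|} := measure_mono hsub
    _ ≤ ENNReal.ofReal ((2 ^ j / 2) ^ (-p)) *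
          eLpNorm (fun x => heatOp μ k t g x - g x) (ENNReal.ofReal p) μ ^ p :=
        measure_le_abs_le_of_enorm_le hp0 hgm (aestronglyMeasurable_heatOp (hk t htpos) hgm) hj
          hsmall
    _ ≤ ENNReal.ofReal ((2 ^ j / 2) ^ (-p)) *
          (ENNReal.ofReal (C * t ^ α) * totalVar μ k p g) ^ p := by
        gcongr
        exact hPPI t htpos g hgW
    _ = _ := by
        rw [ENNReal.mul_rpow_of_nonneg _ _ hp0.le, ← mul_assoc, hmeq,
          ENNReal.ofReal_rpow_of_pos (by positivity), ENNReal.ofReal_rpow_of_pos hmpos,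
          ← ENNReal.ofReal_mul (by positivity), ← ENNReal.ofReal_mul (by positivity)]
        congr 2
        have h1 : (t ^ α) ^ p = (2 ^ p * A) ^ (p * α / β) * m ^ (p * α / β) := by
          rw [← Real.mul_rpow (by positivity) (by positivity), ht,
            ← Real.rpow_mul (by positivity), ← Real.rpow_mul (by positivity)]
          congr 1
          ring
        rw [Real.mul_rpow (by positivity) (by positivity), h1,
          Real.div_rpow (by positivity) (by positivity), Real.rpow_neg two_pos.le]
        field_simp

end

/-! ### Summing the recursion -/

/-- A supremum `M` of the `a j` satisfies `M ≤ D W M^δ`, which yields `M ≤ (D W)^(1/(1-δ))` if `M`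
is finite. Feeding this bound back into the recursion and summing over `j` gives the same bound for
the sum. -/
lemma tsum_le_rpow_of_succ_le_mul_rpow {a V : ℤ → ℝ≥0∞} {D W : ℝ≥0∞} {δ : ℝ} (hδ0 : 0 ≤ δ)
    (hδ1 : δ < 1) (hV : ∑' j, V j ≤ W) (ha : ∀ j, a (j + 1) ≤ D * a j ^ δ * V j)
    (hB : ∀ N : ℤ, ∃ B : ℝ≥0∞, B ≠ ∞ ∧ ∀ j ≤ N, a j ≤ B) :
    ∑' j, a j ≤ (D * W) ^ (1 / (1 - δ)) := by
  have h1δ : 0 < 1 - δ := by linarith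
  set Z := (D * W) ^ (1 / (1 - δ)) with hZ
  have hle : ∀ N, a N ≤ Z := fun N => by
    obtain ⟨B, hB, hBN⟩ := hB N
    -- Restricting to `j ≤ N` makes `M` finite, so `M^δ` can be divided out; the resulting bound is
    -- independent of `N`.
    set M := ⨆ j : Set.Iic N, a j with hM
    have haM : ∀ j ≤ N, a j ≤ M := fun j hj => le_iSup (fun j : Set.Iic N => a j) ⟨j, hj⟩
    have hMfin : M ≠ ∞ := ne_top_of_le_ne_top hB (iSup_le fun j => hBN j j.2)
    have hMM : M ≤ D * W * M ^ δ := iSup_le fun j => by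
      have h := ha (j - 1)
      rw [sub_add_cancel] at h
      calc a j ≤ D * a (j - 1) ^ δ * V (j - 1) := h
        _ ≤ D * M ^ δ * W := by
          gcongr
          · exact haM _ ((sub_one_lt (j : ℤ)).le.trans j.2)
          · exact (ENNReal.le_tsum _).trans hV
        _ = D * W * M ^ δ := by ring
    refine (haM N le_rfl).trans ?_
    rcases eq_or_ne M 0 with h0 | h0
    · simp [h0]
    rw [hZ, one_div, ENNReal.le_rpow_inv_iff h1δ, sub_eq_add_neg, ENNReal.rpow_add _ _ h0 hMfin,
      ENNReal.rpow_one, ENNReal.rpow_neg, ← div_eq_mul_inv]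
    exact ENNReal.div_le_of_le_mul hMM
  calc ∑' j, a j = ∑' j, a (j + 1) := ((Equiv.addRight (1 : ℤ)).tsum_eq a).symm
    _ ≤ ∑' j, D * Z ^ δ * V j := ENNReal.tsum_le_tsum fun j => (ha j).trans (by
        gcongr
        exact hle j)
    _ ≤ D * Z ^ δ * W := by rw [ENNReal.tsum_mul_left]; gcongr
    _ = Z ^ (1 - δ) * Z ^ δ := by
        rw [hZ, ← ENNReal.rpow_mul (D * W) (1 / (1 - δ)) (1 - δ), one_div_mul_cancel h1δ.ne',
          ENNReal.rpow_one]
        ring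
    _ = Z := by
        rw [← ENNReal.rpow_add_of_nonneg _ _ h1δ.le hδ0, sub_add_cancel, ENNReal.rpow_one]

/-! ### Sobolev inequality and interpolation -/

section

variable {X : Type*} [MeasurableSpace X] {μ : Measure X} {k : ℝ → X → X → ℝ≥0}

lemma lintegral_enorm_rpow_le_tsum {q : ℝ} (hq : 0 < q) {f : X → ℝ}
    (hf : AEStronglyMeasurable f μ) :
    ∫⁻ x, ‖f x‖ₑ ^ q ∂μ ≤
      ∑' j : ℤ, ENNReal.ofReal (((2 : ℝ) ^ (j + 1)) ^ q) * μ {x | 2 ^ j ≤ |f x|} := by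
  have hS : ∀ j : ℤ, NullMeasurableSet {x | 2 ^ j ≤ |f x|} μ := fun j =>
    nullMeasurableSet_le aemeasurable_const hf.aemeasurable.abs
  calc ∫⁻ x, ‖f x‖ₑ ^ q ∂μ
      ≤ ∫⁻ x, ∑' j : ℤ, {x | 2 ^ j ≤ |f x|}.indicator
          (fun _ => ENNReal.ofReal (((2 : ℝ) ^ (j + 1)) ^ q)) x ∂μ := by
        refine lintegral_mono fun x => ?_
        rcases eq_or_ne (f x) 0 with h0 | h0
        · simp [h0, hq]
        obtain ⟨j, hj1, hj2⟩ := exists_mem_Ico_zpow (abs_pos.2 h0) (one_lt_two (α := ℝ))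
        refine le_trans ?_ (ENNReal.le_tsum j)
        rw [Set.indicator_of_mem (show x ∈ {x | 2 ^ j ≤ |f x|} from hj1),
          Real.enorm_eq_ofReal_abs, ENNReal.ofReal_rpow_of_pos (abs_pos.2 h0)]
        gcongr
    _ = _ := by
        rw [lintegral_tsum fun j => aemeasurable_const.indicator₀ (hS j)]
        refine tsum_congr fun j => ?_
        rw [lintegral_indicator₀ (hS j), setLIntegral_const]

lemma eLpNorm_le_mul_totalVar [SigmaFinite μ] {β : ℝ} (hβ : 0 < β)
    (hk : ∀ t : ℝ, 0 < t → Measurable fun z : X × X => k t z.1 z.2)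
    (hcons : IsConservative μ k) (hbound : HeatKernelUpperBound μ k β)
    {p : ℝ} (hp : 1 ≤ p) (hPPI : PseudoPoincare μ k p) (hpβ : p * critExponent μ k p < β) :
    ∃ C : ℝ, 0 < C ∧ ∀ f ∈ sobolevClass μ k p,
      eLpNorm f (ENNReal.ofReal (p / (1 - p * critExponent μ k p / β))) μ ≤
        ENNReal.ofReal C * totalVar μ k p f := by
  obtain ⟨K, hK, hlevel⟩ := measure_level_succ_le hβ hk hcons hbound hp hPPI
  have hp0 : 0 < p := by linarith
  set δ := p * critExponent μ k p / β with hδ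
  have hδ0 : 0 ≤ δ := div_nonneg (mul_nonneg hp0.le (critExponent_nonneg p)) hβ.le
  have hδ1 : δ < 1 := (div_lt_one hβ).2 hpβ
  have h1δ : 0 < 1 - δ := by linarith
  set q := p / (1 - δ) with hq
  have hq0 : 0 < q := by positivity
  have hqp : q * (1 - δ) = p := div_mul_cancel₀ _ h1δ.ne'
  have hpq : p ≤ q := by nlinarith
  have hpow : ∀ j : ℤ, ((2 : ℝ) ^ (j + 1)) ^ q = 2 ^ q * (2 ^ j) ^ q := fun j => by
    rw [zpow_add_one₀ two_ne_zero, Real.mul_rpow (by positivity) two_pos.le, mul_comm]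
  refine ⟨2 * (2 ^ q * K) ^ (1 / p), by positivity, fun f hf => ?_⟩
  have hfm : AEStronglyMeasurable f μ := hf.1.1
  set a : ℤ → ℝ≥0∞ := fun j => ENNReal.ofReal (((2 : ℝ) ^ j) ^ q) * μ {x | 2 ^ j ≤ |f x|} with ha
  have hsum : ∑' j, a j ≤
      (ENNReal.ofReal (2 ^ q * K) * totalVar μ k p f ^ p) ^ (1 / (1 - δ)) := by
    refine tsum_le_rpow_of_succ_le_mul_rpow hδ0 hδ1 (tsum_totalVar_dyadicSlice_rpow_le hp f)
      (fun j => ?_) fun N => ?_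
    · have hj : (0 : ℝ) < 2 ^ j := by positivity
      refine (mul_le_mul_right (hlevel f hf j) _).trans_eq ?_
      rw [ha, ENNReal.mul_rpow_of_nonneg _ _ hδ0, ENNReal.ofReal_rpow_of_pos (by positivity),
        ← mul_assoc, ← mul_assoc, ← mul_assoc, ← ENNReal.ofReal_mul (by positivity),
        ← ENNReal.ofReal_mul (by positivity)]
      congr 3
      -- The choice of `q` gives `q δ = q - p`, so the powers of `2^j` balance.
      rw [hpow, ← Real.rpow_mul hj.le, show q * δ = q + -p by linarith, Real.rpow_add hj]
      ring
    -- Chebyshev gives `a j ≤ 2^(j(q-p)) ‖f‖_p^p`, nondecreasing in `j` as `q ≥ p`.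
    · refine ⟨ENNReal.ofReal (((2 : ℝ) ^ N) ^ (q - p)) * eLpNorm f (ENNReal.ofReal p) μ ^ p,
        ENNReal.mul_ne_top ENNReal.ofReal_ne_top
          (ENNReal.rpow_ne_top_of_nonneg hp0.le hf.1.2.ne), fun j hj => ?_⟩
      have hj0 : (0 : ℝ) < 2 ^ j := by positivity
      refine (mul_le_mul_right (measure_le_abs_le hp0 hfm hj0) _).trans ?_
      rw [← mul_assoc, ← ENNReal.ofReal_mul (by positivity), ← Real.rpow_add hj0,
        ← sub_eq_add_neg]
      gcongr
      exact one_le_two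
  have hint : ∫⁻ x, ‖f x‖ₑ ^ q ∂μ ≤ ENNReal.ofReal (2 ^ q) *
      (ENNReal.ofReal (2 ^ q * K) * totalVar μ k p f ^ p) ^ (1 / (1 - δ)) := by
    refine (lintegral_enorm_rpow_le_tsum hq0 hfm).trans ?_
    simp only [hpow, ENNReal.ofReal_mul (show (0 : ℝ) ≤ 2 ^ q by positivity), mul_assoc,
      ENNReal.tsum_mul_left]
    rw [ENNReal.ofReal_mul (by positivity), mul_assoc] at hsum
    gcongr
  rw [eLpNorm_eq_lintegral_rpow_enorm_toReal (by simpa using hq0) (by simp),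
    ENNReal.toReal_ofReal hq0.le]
  refine (ENNReal.rpow_le_rpow hint (by positivity)).trans_eq ?_
  have hexp : 1 / (1 - δ) * (1 / q) = 1 / p := by rw [hq]; field_simp
  rw [ENNReal.mul_rpow_of_nonneg _ _ (by positivity), ← ENNReal.rpow_mul _ (1 / (1 - δ)), hexp,
    ENNReal.mul_rpow_of_nonneg _ _ (by positivity), ← ENNReal.rpow_mul _ p,
    mul_one_div_cancel hp0.ne', ENNReal.rpow_one, ENNReal.ofReal_rpow_of_pos (by positivity),
    ENNReal.ofReal_rpow_of_pos (by positivity), ← Real.rpow_mul two_pos.le,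
    mul_one_div_cancel hq0.ne', Real.rpow_one, ← mul_assoc, ← ENNReal.ofReal_mul two_pos.le]

/-- Hölder for `|f| = |f|^θ |f|^(1-θ)` with exponents `q/θ` and `s/(1-θ)`; `θ = 1` is treated apart
to avoid dividing by `0`. -/
lemma eLpNorm_le_eLpNorm_rpow_mul_eLpNorm_rpow {f : X → ℝ} (hf : AEStronglyMeasurable f μ)
    {q r s : ℝ≥0∞} {θ : ℝ} (hθ0 : 0 < θ) (hθ1 : θ ≤ 1)
    (h : r⁻¹ = ENNReal.ofReal θ * q⁻¹ + ENNReal.ofReal (1 - θ) * s⁻¹) :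
    eLpNorm f r μ ≤ eLpNorm f q μ ^ θ * eLpNorm f s μ ^ (1 - θ) := by
  rcases hθ1.eq_or_lt with rfl | hθ1
  · obtain rfl : r = q := inv_injective (by simpa using h)
    simp
  have h1 : 0 < 1 - θ := by linarith
  have hne : ∀ {c : ℝ}, 0 < c → ENNReal.ofReal c ≠ 0 := fun hc => by simpa using hc
  have hinv : ∀ (u : ℝ≥0∞) {c : ℝ}, 0 < c →
      (u / ENNReal.ofReal c)⁻¹ = ENNReal.ofReal c * u⁻¹ := fun u c hc => by
    rw [ENNReal.inv_div (Or.inl ENNReal.ofReal_ne_top) (Or.inl (hne hc)), div_eq_mul_inv]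
  have : ENNReal.HolderTriple (q / ENNReal.ofReal θ) (s / ENNReal.ofReal (1 - θ)) r :=
    ⟨by rw [hinv q hθ0, hinv s h1, h]⟩
  have key := eLpNorm_smul_le_mul_eLpNorm (μ := μ) (p := q / ENNReal.ofReal θ)
    (q := s / ENNReal.ofReal (1 - θ)) (r := r)
    (f := fun x => ‖f x‖ ^ (1 - θ)) (φ := fun x => ‖f x‖ ^ θ)
    (hf.norm.aemeasurable.pow_const _).aestronglyMeasurable
    (hf.norm.aemeasurable.pow_const _).aestronglyMeasurable
  rw [eLpNorm_norm_rpow f hθ0, eLpNorm_norm_rpow f h1,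
    ENNReal.div_mul_cancel (hne hθ0) ENNReal.ofReal_ne_top,
    ENNReal.div_mul_cancel (hne h1) ENNReal.ofReal_ne_top] at key
  refine le_of_eq_of_le (eLpNorm_congr_norm_ae (Eventually.of_forall fun x => ?_)) key
  have hx : ‖f x‖ ^ θ * ‖f x‖ ^ (1 - θ) = ‖f x‖ := by
    rw [← Real.rpow_add_of_nonneg (norm_nonneg _) hθ0.le h1.le, add_sub_cancel, Real.rpow_one]
  simp only [Pi.smul_apply', smul_eq_mul, hx, norm_norm]

end

theorem corollaryC {X : Type*} [MeasurableSpace X] (μ : Measure X) [SigmaFinite μ]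
    (𝓔 : DirichletForm μ)
    (P : ℝ → (Lp ℝ 2 μ →L[ℝ] Lp ℝ 2 μ)) (hP : 𝓔.IsHeatSemigroup P)
    (k : ℝ → X → X → ℝ≥0) (hk : IsHeatKernel μ P k) (hcons : IsConservative μ k)
    (β : ℝ) (hβ : 0 < β) (hbound : HeatKernelUpperBound μ k β)
    (p : ℝ) (hp : 1 ≤ p) (hPPI : PseudoPoincare μ k p)
    (hpβ : p * critExponent μ k p < β)
    (r s : ℝ≥0∞) (hr : 1 ≤ r) (hs : 1 ≤ s) :
    ∃ C : ℝ, 0 < C ∧ ∀ θ : ℝ, 0 < θ → θ ≤ 1 →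
      (r⁻¹).toReal = θ * (1 / p - critExponent μ k p / β) + (1 - θ) * (s⁻¹).toReal →
      ∀ f ∈ sobolevClass μ k p,
        eLpNorm f r μ
          ≤ ENNReal.ofReal C * totalVar μ k p f ^ θ * eLpNorm f s μ ^ (1 - θ) := by
  obtain ⟨C, hC, hsob⟩ := eLpNorm_le_mul_totalVar hβ hk.measurable hcons hbound hp hPPI hpβ
  -- `C ^ θ ≤ max C 1` for all `θ ∈ (0, 1]`, so the constant does not depend on `θ`.
  refine ⟨max C 1, by positivity, fun θ hθ0 hθ1 hθ f hf => ?_⟩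
  have hp0 : 0 < p := by linarith
  have hq0 : 0 < p / (1 - p * critExponent μ k p / β) :=
    div_pos hp0 (sub_pos.2 ((div_lt_one hβ).2 hpβ))
  have hexp : 1 / p - critExponent μ k p / β = (p / (1 - p * critExponent μ k p / β))⁻¹ := by
    rw [inv_div]
    field_simp
  set q := p / (1 - p * critExponent μ k p / β)
  have hrs : r⁻¹ = ENNReal.ofReal θ * (ENNReal.ofReal q)⁻¹ + ENNReal.ofReal (1 - θ) * s⁻¹ := by
    have hfin : ∀ {u : ℝ≥0∞}, 1 ≤ u → u⁻¹ ≠ ∞ := fun hu =>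
      ENNReal.inv_ne_top.2 (zero_lt_one.trans_le hu).ne'
    rw [← ENNReal.ofReal_toReal (hfin hr), ← ENNReal.ofReal_toReal (hfin hs), hθ, hexp,
      ← ENNReal.ofReal_inv_of_pos hq0, ← ENNReal.ofReal_mul hθ0.le,
      ← ENNReal.ofReal_mul (by linarith), ← ENNReal.ofReal_add (by positivity)
        (mul_nonneg (by linarith) ENNReal.toReal_nonneg)]
  refine (eLpNorm_le_eLpNorm_rpow_mul_eLpNorm_rpow hf.1.1 hθ0 hθ1 hrs).trans ?_
  gcongr
  calc eLpNorm f (ENNReal.ofReal q) μ ^ θ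
      ≤ (ENNReal.ofReal C * totalVar μ k p f) ^ θ := ENNReal.rpow_le_rpow (hsob f hf) hθ0.le
    _ = ENNReal.ofReal (C ^ θ) * totalVar μ k p f ^ θ := by
        rw [ENNReal.mul_rpow_of_nonneg _ _ hθ0.le, ENNReal.ofReal_rpow_of_pos hC]
    _ ≤ ENNReal.ofReal (max C 1) * totalVar μ k p f ^ θ := by
        gcongr
        calc C ^ θ ≤ max C 1 ^ θ := by gcongr; exact le_max_left _ _
          _ ≤ max C 1 ^ (1 : ℝ) := Real.rpow_le_rpow_of_exponent_le (le_max_right _ _) hθ1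
          _ = max C 1 := Real.rpow_one _
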